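/- Let $n\ge 2$ and let $M,N\subset\mathbb R^n$ be smooth compact hypersurfaces which are the boundaries of bounded strictly convex domains (a bounded open convex set is called strictly convex if its boundary contains no nondegenerate segment). Put $c_2(x,y)=\tfrac12|x-y|^2$. Let $\mu=f\,dv$ and $\nu=g\,dv$ be probability measures on $M$ and $N$, where $f:M\to\mathbb R$, $g:N\to\mathbb R$ are continuous and nonnegative and $dv$ denotes the volume ($(n-1)$-dimensional surface) measure. A plan is a probability measure $\pi$ on $M\times N$ with marginals $\mu$ and $\nu$; it is optimal if it minimizes $\int c_2\,d\pi$ among all plans. For $\eta:M\to\mathbb R$ and $y\in N$ set $$\eta^*(y)=\inf_{x\in M}\bigl(c_2(x,y)-\eta(x)\bigr),\qquad \eta^\Box(y)=\sup_{x\in M}\bigl(c_2(x,y)-\eta(x)\bigr),$$ and define $\eta^*,\eta^\Box:M\to\mathbb R$ in the same way for $\eta:N\to\mathbb R$, with the roles of $M$ and $N$ exchanged. Let $(\varphi,\psi)\in C^0(M)\times C^0(N)$ attain the maximum of $\int_M\varphi\,d\mu+\int_N\psi\,d\nu$ among all pairs of continuous functions with $\varphi(x)+\psi(y)\le c_2(x,y)$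 for all $(x,y)\in M\times N$, and suppose that $\psi=\varphi^*$ and $\varphi=\psi^*$. For $y\in N$ let $\Theta_y(x)=c_2(x,y)-\varphi(x)$ $(x\in M)$, let $$\Gamma=\{x\in M:\ \exists\,y\in N,\ \Theta_y(x)=\max_M\Theta_y\},$$ and for $x\in M$ let $\Omega_x\subset N$ be the set of minimizers over $N$ of $y\mapsto c_2(x,y)-\psi(y)$. Then: 1. $\Gamma$ is closed. 2. Suppose that $f$ vanishes nowhere on $M$. Then for every $x\in\Gamma$ the set $\Omega_x$ consists of exactly one point. In particular, if $\Gamma=M$, then there is a continuous map $T:M\to N$ with $T_\#\mu=\nu$ such that the support of every optimal plan $\pi$ is contained in the graph of $T$. 3. For every $x\in\Gamma$ one has $\varphi^{\Box\Box}(x)=\varphi(x)=\varphi^{**}(x)$. -/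

import Mathlib

open MeasureTheory
open scoped ContDiff

namespace Transport

/-- A smooth (embedded) hypersurface of `ℝⁿ`: near each of its points it is the zero set of a
smooth function whose differential does not vanish at the point. -/
def IsSmoothHypersurface {n : ℕ} (M : Set (EuclideanSpace ℝ (Fin n))) : Prop :=
  ∀ p ∈ M, ∃ (U : Set (EuclideanSpace ℝ (Fin n))) (F : EuclideanSpace ℝ (Fin n) → ℝ),
    IsOpen U ∧ p ∈ U ∧ ContDiffOn ℝ ∞ F U ∧ fderiv ℝ F p ≠ 0 ∧ M ∩ U = {x ∈ U | F x = 0}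

/-- A bounded strictly convex domain of `ℝⁿ`: a nonempty bounded open convex set such that the open
segment between two distinct points of the closure lies in the interior (for an open set,
strict convexity has to be asked of the closure: it then says that the boundary contains no
nondegenerate segment). -/
structure IsStrictlyConvexDomain {n : ℕ} (D : Set (EuclideanSpace ℝ (Fin n))) : Prop where
  nonempty : D.Nonempty
  isOpen : IsOpen D
  isBounded : Bornology.IsBounded D
  convex : Convex ℝ D
  strictConvex_closure : StrictConvex ℝ (closure D)

/-- A smooth compact hypersurface of `ℝⁿ` that bounds a strictly convex domain. -/
structure IsStrictlyConvexHypersurface {n : ℕ} (M : Set (EuclideanSpace ℝ (Fin n))) : Prop where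
  isCompact : IsCompact M
  smooth : IsSmoothHypersurface M
  bounds : ∃ D : Set (EuclideanSpace ℝ (Fin n)), IsStrictlyConvexDomain D ∧ M = frontier D

/-- The quadratic cost `c₂(x, y) = ½ |x - y|²`. -/
noncomputable def cost {n : ℕ} (x y : EuclideanSpace ℝ (Fin n)) : ℝ := 1 / 2 * ‖x - y‖ ^ 2

/-- The measure `f dv` on a hypersurface `M` of `ℝⁿ`, where `dv` is the volume measure of `M`, that
is, its `(n-1)`-dimensional Hausdorff measure in the Euclidean normalization. -/
noncomputable def densityMeasure {n : ℕ} (M : Set (EuclideanSpace ℝ (Fin n))) (f : M → ℝ) :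
    Measure M :=
  (Measure.euclideanHausdorffMeasure (n - 1) : Measure M).withDensity
    (fun x => ENNReal.ofReal (f x))

section

variable {n : ℕ} {A B : Set (EuclideanSpace ℝ (Fin n))}

/-- `η*(y) = inf_{x ∈ A} (c₂(x, y) - η(x))` for `η : A → ℝ` and `y ∈ B`. It is used with
`(A, B) = (M, N)` and with `(A, B) = (N, M)`. -/
noncomputable def starTransform (B : Set (EuclideanSpace ℝ (Fin n))) (η : A → ℝ) : B → ℝ :=
  fun y => ⨅ x : A, (cost (x : EuclideanSpace ℝ (Fin n)) y - η x)

/-- `η^□(y) = sup_{x ∈ A} (c₂(x, y) - η(x))` for `η : A → ℝ` and `y ∈ B`. -/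
noncomputable def boxTransform (B : Set (EuclideanSpace ℝ (Fin n))) (η : A → ℝ) : B → ℝ :=
  fun y => ⨆ x : A, (cost (x : EuclideanSpace ℝ (Fin n)) y - η x)

/-- `Θ_y(x) = c₂(x, y) - η(x)` for `η : A → ℝ`, `x ∈ A` and `y ∈ B`. With `η = φ` this is the
function `Θ_y` on `M`; with `η = ψ` it is the function `Θ_x` on `N`. -/
noncomputable def Theta (η : A → ℝ) (y : B) (x : A) : ℝ :=
  cost (x : EuclideanSpace ℝ (Fin n)) y - η x

/-- The set of minimizers of `Θ_y`. For `x ∈ M`, `Omega ψ x` is `Ω_x ⊆ N`, the set of minimizers of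
`z ↦ ½ |x - z|² - ψ(z)`. -/
def Omega (η : A → ℝ) (y : B) : Set A :=
  {x | ∀ z : A, Theta η y x ≤ Theta η y z}

/-- `Γ`: the points of `M` at which some `Θ_y`, `y ∈ N`, attains its maximum over `M`. -/
def Gamma (N : Set (EuclideanSpace ℝ (Fin n))) {M : Set (EuclideanSpace ℝ (Fin n))}
    (φ : M → ℝ) : Set M :=
  {x | ∃ y : N, ∀ z : M, Theta φ y z ≤ Theta φ y x}

/-- `π ∈ Π(μ, ν)`: a probability measure on `M × N` with marginals `μ` and `ν`. -/
structure IsPlan (μ : Measure A) (ν : Measure B) (π : Measure (A × B)) : Prop where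
  isProbabilityMeasure : IsProbabilityMeasure π
  map_fst : π.map Prod.fst = μ
  map_snd : π.map Prod.snd = ν

/-- The transport cost `∫ c₂ dπ` of a plan. -/
noncomputable def planCost (π : Measure (A × B)) : ℝ :=
  ∫ p, cost (p.1 : EuclideanSpace ℝ (Fin n)) (p.2 : EuclideanSpace ℝ (Fin n)) ∂π

/-- An optimal transference plan: a minimizer of `∫ c₂ dπ` over `Π(μ, ν)`. -/
structure IsOptimalPlan (μ : Measure A) (ν : Measure B) (π : Measure (A × B)) : Prop where
  isPlan : IsPlan μ ν π
  planCost_le : ∀ π' : Measure (A × B), IsPlan μ ν π' → planCost π ≤ planCost π'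

/-- The constraint set of the dual problem: continuous `φ`, `ψ` with `φ(x) + ψ(y) ≤ c₂(x, y)`. -/
structure IsAdmissible (φ : A → ℝ) (ψ : B → ℝ) : Prop where
  continuous_left : Continuous φ
  continuous_right : Continuous ψ
  add_le : ∀ (x : A) (y : B), φ x + ψ y ≤ cost (x : EuclideanSpace ℝ (Fin n)) y

/-- The dual functional `J₀(φ, ψ) = ∫ φ dμ + ∫ ψ dν`. -/
noncomputable def dualValue (μ : Measure A) (ν : Measure B) (φ : A → ℝ) (ψ : B → ℝ) : ℝ :=
  (∫ x, φ x ∂μ) + ∫ y, ψ y ∂ν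

/-- `(φ, ψ)` attains the supremum in the dual Kantorovich problem and satisfies
`ψ = φ*`, `φ = ψ*`. -/
structure IsKantorovichPair (μ : Measure A) (ν : Measure B) (φ : A → ℝ) (ψ : B → ℝ) : Prop where
  admissible : IsAdmissible φ ψ
  dualValue_le : ∀ (φ' : A → ℝ) (ψ' : B → ℝ), IsAdmissible φ' ψ' →
    dualValue μ ν φ' ψ' ≤ dualValue μ ν φ ψ
  eq_star_left : ψ = starTransform B φ
  eq_star_right : φ = starTransform A ψ

end

end Transport

namespace Transport

/-! Let `Θ_{y₀}` be maximal at `x ∈ Γ` and let `y` be a contact of `x`: `φ(x) + ψ(y) = c₂(x, y)`.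
Then `x` minimizes `c₂(·, y) - φ` and maximizes `c₂(·, y₀) - φ`, hence minimizes over `M` their
difference, which is affine. So `y - y₀` is normal to `M` at `x` (`inner_le_of_mem_contactSet`), and
`y₀` and all contacts of `x` lie on one line, which meets `N` in at most two points. Two contacts
therefore agree unless one of them is `y₀`.

If `y₀` is a contact, `Θ_{y₀}` is constant and `y₀` is in contact with all of `M`. Then some
nonempty open part of `M` has `y₀` as its only contact; its positive mass would have to go to `y₀`,
but `ν` has no atoms (`exists_notMem_contactSet`).

Such mass comparisons come from the first variation of the dual functional
(`integral_add_integral_nonpos`), which also gives `T_# μ = ν`. Complementary slackness places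
optimal plans on the contact set. -/

/-! ### Convex domains and their frontiers. -/

theorem inter_frontier_nonempty_of_isPreconnected {X : Type*} [TopologicalSpace X] {s D : Set X}
    (hs : IsPreconnected s) (hD : IsOpen D) (h₁ : (s ∩ D).Nonempty) (h₂ : ¬ s ⊆ D) :
    (s ∩ frontier D).Nonempty := by
  by_contra hne
  refine h₂ (hs.subset_left_of_subset_union hD isClosed_closure.isOpen_compl
    (disjoint_compl_right.mono_left subset_closure) (fun x hx => ?_) h₁)
  by_contra hx'
  rw [Set.mem_union, not_or, Set.mem_compl_iff, not_not] at hx'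
  exact hne ⟨x, hx, hx'.2, by rw [hD.interior_eq]; exact hx'.1⟩

section Convex

variable {E : Type*} [NormedAddCommGroup E] [InnerProductSpace ℝ E]

/-- A ray from a point of a bounded open set leaves the set through its frontier. -/
theorem exists_pos_add_smul_mem_frontier {D : Set E} (hD : IsOpen D)
    (hb : Bornology.IsBounded D) {w d : E} (hw : w ∈ D) (hd : d ≠ 0) :
    ∃ t : ℝ, 0 < t ∧ w + t • d ∈ frontier D := by
  obtain ⟨R, hR⟩ := hb.subset_closedBall w
  have hd' : 0 < ‖d‖ := norm_pos_iff.2 hd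
  have hc : Continuous fun t : ℝ => w + t • d := by fun_prop
  obtain ⟨_, ⟨t, ht, rfl⟩, hx⟩ := inter_frontier_nonempty_of_isPreconnected
    (isPreconnected_Ici.image (fun t : ℝ => w + t • d) hc.continuousOn (s := Set.Ici 0)) hD
    ⟨w, ⟨0, by simp, by simp⟩, hw⟩ (fun hsub => by
      have h := hR (hsub ⟨(|R| + 1) / ‖d‖, by simp only [Set.mem_Ici]; positivity, rfl⟩)
      rw [Metric.mem_closedBall, dist_eq_norm, add_sub_cancel_left, norm_smul, Real.norm_eq_abs,
        abs_of_nonneg (by positivity), div_mul_cancel₀ _ hd'.ne'] at h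
      linarith [le_abs_self R])
  refine ⟨t, lt_of_le_of_ne ht ?_, hx⟩
  rintro rfl
  have : w ∉ D := by simpa [hD.interior_eq] using hx.2
  exact this hw

/-- A linear functional bounded on the frontier of a bounded open set satisfies the strict bound
inside. -/
theorem inner_lt_of_forall_frontier {D : Set E} (hD : IsOpen D)
    (hb : Bornology.IsBounded D) {d : E} {c : ℝ} (hd : d ≠ 0)
    (h : ∀ z ∈ frontier D, inner ℝ d z ≤ c) {w : E} (hw : w ∈ D) : inner ℝ d w < c := by
  obtain ⟨t, ht, hz⟩ := exists_pos_add_smul_mem_frontier hD hb hw hd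
  have h' := h _ hz
  rw [inner_add_right, inner_smul_right, real_inner_self_eq_norm_sq] at h'
  have : 0 < t * ‖d‖ ^ 2 := mul_pos ht (pow_pos (norm_pos_iff.2 hd) 2)
  linarith

/-- A supporting hyperplane at a frontier point of an open convex set. -/
theorem exists_supporting_normal [CompleteSpace E] {D : Set E} (hD : IsOpen D)
    (hne : D.Nonempty) (hconv : Convex ℝ D) {y₀ : E} (hy₀ : y₀ ∈ frontier D) :
    ∃ e : E, e ≠ 0 ∧ ∀ y ∈ closure D, inner ℝ e y ≤ inner ℝ e y₀ := by
  have hy : y₀ ∉ D := by simpa [hD.interior_eq] using hy₀.2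
  obtain ⟨ℓ, hℓ⟩ := geometric_hahn_banach_open_point hconv hD hy
  have hin : ∀ y, inner ℝ ((InnerProductSpace.toDual ℝ E).symm ℓ) y = ℓ y := fun y =>
    InnerProductSpace.toDual_symm_apply
  refine ⟨(InnerProductSpace.toDual ℝ E).symm ℓ, ?_, fun y hyD => ?_⟩
  · intro h0
    obtain ⟨q, hq⟩ := hne
    have := hℓ q hq
    rw [← hin, ← hin, h0] at this
    simp at this
  · rw [hin, hin]
    exact closure_minimal (fun a ha => (hℓ a ha).le)
      (isClosed_le ℓ.continuous continuous_const) hyD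

/-- The frontier of an open set with strictly convex closure contains no three distinct collinear
points. -/
theorem not_collinear_of_mem_frontier {D : Set E} (hD : IsOpen D) (hconv : Convex ℝ D)
    (hne : D.Nonempty) (hs : StrictConvex ℝ (closure D)) {a b c : E} (ha : a ∈ frontier D)
    (hb : b ∈ frontier D) (hc : c ∈ frontier D) (hab : a ≠ b) (hbc : b ≠ c) (hca : c ≠ a) :
    ¬ Collinear ℝ {a, b, c} := by
  have key : ∀ {x y z : E}, x ∈ frontier D → y ∈ frontier D → z ∈ frontier D →
      x ≠ y → y ≠ z → z ≠ x → ¬ Wbtw ℝ x y z := by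
    intro x y z hx hy hz hxy hyz hzx hw
    have hy' : y ∈ openSegment ℝ x z :=
      mem_openSegment_of_ne_left_right hxy hyz.symm (mem_segment_iff_wbtw.2 hw)
    have h2 := hs.openSegment_subset hx.1 hz.1 hzx.symm hy'
    rw [hconv.interior_closure_eq_interior_of_nonempty_interior
      (by rwa [hD.interior_eq])] at h2
    exact hy.2 h2
  intro hcol
  rcases hcol.wbtw_or_wbtw_or_wbtw with h | h | h
  · exact key ha hb hc hab hbc hca h
  · exact key hb hc ha hbc hca hab h
  · exact key hc ha hb hca hab hbc h

end Convex

/-! ### Normals and surface measure of hypersurfaces. -/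

variable {n : ℕ}

/-- Any two linear functionals attaining a maximum over a smooth hypersurface at the same point are
proportional to one normal vector. -/
theorem IsSmoothHypersurface.exists_normal {M : Set (EuclideanSpace ℝ (Fin n))}
    (hM : IsSmoothHypersurface M) {x : EuclideanSpace ℝ (Fin n)} (hx : x ∈ M) :
    ∃ v : EuclideanSpace ℝ (Fin n), ∀ d, (∀ z ∈ M, inner ℝ d z ≤ inner ℝ d x) →
      ∃ r : ℝ, d = r • v := by
  obtain ⟨U, F, hU, hxU, hF, hdF, hMU⟩ := hM x hx
  have hUx : U ∈ nhds x := hU.mem_nhds hxU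
  have hFx : F x = 0 := by
    have : x ∈ M ∩ U := ⟨hx, hxU⟩
    rw [hMU] at this
    exact this.2
  have hF' : HasStrictFDerivAt F (fderiv ℝ F x) x :=
    (hF.contDiffAt hUx).hasStrictFDerivAt (by simp)
  refine ⟨(InnerProductSpace.toDual ℝ _).symm (fderiv ℝ F x), fun d hd => ?_⟩
  have hext : IsLocalExtrOn (fun z => innerSL ℝ d z) {z | F z = F x} x := by
    refine Or.inr ?_
    filter_upwards [mem_nhdsWithin_of_mem_nhds hUx, self_mem_nhdsWithin] with z hzU hz
    have hzM : z ∈ M ∩ U := by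
      rw [hMU]
      exact ⟨hzU, hz.trans hFx⟩
    exact hd z hzM.1
  obtain ⟨a, b, hab, h⟩ := hext.exists_multipliers_of_hasStrictFDerivAt_1d hF'
    (innerSL ℝ d).hasStrictFDerivAt
  -- A vanishing multiplier of `d` would leave a nonzero multiple of `dF(x)` equal to zero.
  have hb : b ≠ 0 := by
    rintro rfl
    have ha : a ≠ 0 := fun ha => hab (by rw [ha]; rfl)
    rw [zero_smul, add_zero] at h
    exact (smul_ne_zero ha hdF) h
  refine ⟨-(b⁻¹ * a), ext_inner_right ℝ fun z => ?_⟩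
  have hz := congrArg (fun L : StrongDual ℝ (EuclideanSpace ℝ (Fin n)) => L z) h
  simp only [_root_.add_apply, _root_.smul_apply, smul_eq_mul, innerSL_apply_apply,
    _root_.zero_apply] at hz
  rw [real_inner_smul_left, InnerProductSpace.toDual_symm_apply]
  field_simp
  linarith

/-- Relatively open subsets of the boundary of an open convex set have positive codimension-one
Hausdorff measure. -/
theorem isOpenPosMeasure_frontier {D : Set (EuclideanSpace ℝ (Fin n))} (hn : 1 ≤ n)
    (hD : IsOpen D) (hconv : Convex ℝ D) (hne : D.Nonempty) :
    (Measure.euclideanHausdorffMeasure (n - 1) : Measure (frontier D)).IsOpenPosMeasure := by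
  refine ⟨fun O hO ⟨⟨z, hz⟩, hzO⟩ => ?_⟩
  obtain ⟨U, hU, rfl⟩ := isOpen_induced_iff.1 hO
  obtain ⟨q, hq⟩ := hne
  have hzD : z ∉ D := by simpa [hD.interior_eq] using hz.2
  -- Project along `v` onto its orthogonal hyperplane. Lines parallel to `v` near `z` cross the
  -- frontier inside `U`, so the image of `U ∩ frontier D` contains a ball; a 1-Lipschitz map does
  -- not increase Hausdorff measure.
  set v := q - z with hv
  have hv0 : v ≠ 0 := sub_ne_zero.2 fun h => hzD (h ▸ hq)
  let W : Submodule ℝ (EuclideanSpace ℝ (Fin n)) := (Submodule.span ℝ {v})ᗮ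
  have hfin : Module.finrank ℝ W = n - 1 := by
    have : Fact (Module.finrank ℝ (EuclideanSpace ℝ (Fin n)) = (n - 1) + 1) :=
      ⟨by rw [finrank_euclideanSpace_fin]; omega⟩
    exact Submodule.finrank_orthogonal_span_singleton hv0
  let P : EuclideanSpace ℝ (Fin n) →L[ℝ] W := W.orthogonalProjectionOnto
  have hPv : P v = 0 := by
    apply Submodule.orthogonalProjectionOnto_eq_zero_iff.2
    exact Submodule.le_orthogonal_orthogonal _ (Submodule.mem_span_singleton_self v)
  have hPw : ∀ w : W, P w = w := fun w =>
    Submodule.orthogonalProjectionOnto_mem_subspace_eq_self w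
  obtain ⟨r, hr, hrU⟩ := Metric.isOpen_iff.1 hU z hzO
  have hvpos : 0 < ‖v‖ := norm_pos_iff.2 hv0
  obtain ⟨s, hs0, hs1, hsr⟩ : ∃ s : ℝ, 0 < s ∧ s < 1 ∧ s * ‖v‖ < r / 2 := by
    refine ⟨min (1 / 2) (r / 4 / ‖v‖), by positivity,
      (min_le_left _ _).trans_lt (by norm_num), ?_⟩
    calc _ ≤ r / 4 / ‖v‖ * ‖v‖ := by gcongr; exact min_le_right _ _
      _ = r / 4 := by field_simp
      _ < r / 2 := by linarith
  have hin : z + s • v ∈ D := by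
    have := hconv.openSegment_interior_closure_subset_interior
      (by rwa [hD.interior_eq]) hz.1 (x := q) (y := z)
      ⟨s, 1 - s, hs0, by linarith, by ring, rfl⟩
    rw [hD.interior_eq] at this
    convert this using 1
    rw [hv, smul_sub, sub_smul, one_smul]
    abel
  -- Otherwise `z` would lie strictly between a point of the closure and the interior point `q`,
  -- hence in `D`.
  have hout : z - s • v ∉ closure D := fun hcl => by
    have := hconv.openSegment_interior_closure_subset_interior
      (by rwa [hD.interior_eq]) hcl (x := q) (y := z - s • v)
      ⟨s / (1 + s), 1 / (1 + s), by positivity, by positivity, by field_simp; ring, rfl⟩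
    rw [hD.interior_eq] at this
    refine hzD ?_
    convert this using 1
    rw [hv]
    have : (1 + s) ≠ 0 := by positivity
    match_scalars <;> field_simp <;> ring
  obtain ⟨ρ, hρ, hρr, hρin, hρout⟩ : ∃ ρ : ℝ, 0 < ρ ∧ ρ < r / 2 ∧
      Metric.ball (z + s • v) ρ ⊆ D ∧ Metric.ball (z - s • v) ρ ⊆ (closure D)ᶜ := by
    obtain ⟨ρ₁, h₁, h₁'⟩ := Metric.isOpen_iff.1 hD _ hin
    obtain ⟨ρ₂, h₂, h₂'⟩ := Metric.isOpen_iff.1 isClosed_closure.isOpen_compl _ hout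
    refine ⟨min (r / 4) (min ρ₁ ρ₂), by positivity,
      (min_le_left _ _).trans_lt (by linarith), ?_, ?_⟩
    · exact (Metric.ball_subset_ball ((min_le_right _ _).trans (min_le_left _ _))).trans h₁'
    · exact (Metric.ball_subset_ball ((min_le_right _ _).trans (min_le_right _ _))).trans h₂'
  have himage : Metric.ball (P z) ρ ⊆
      (fun x : frontier D => P x) '' (Subtype.val ⁻¹' U) := by
    intro b hb
    set w : W := b - P z with hw
    have hwn : ‖(w : EuclideanSpace ℝ (Fin n))‖ < ρ := by
      have : ‖w‖ < ρ := by rwa [hw, ← dist_eq_norm]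
      exact this
    have hc : Continuous fun t : ℝ => z + w + t • v := by fun_prop
    obtain ⟨_, ⟨t, ht, rfl⟩, hx⟩ := inter_frontier_nonempty_of_isPreconnected
      (isPreconnected_Icc.image (fun t : ℝ => z + w + t • v) hc.continuousOn
        (s := Set.Icc (-s) s)) hD
      ⟨_, ⟨s, ⟨by linarith, le_rfl⟩, rfl⟩, hρin (by
        rw [Metric.mem_ball, dist_eq_norm]
        rw [show z + w + s • v - (z + s • v) = w by abel]
        exact hwn)⟩
      (fun hsub => by
        refine hρout (a := z + w + (-s) • v) ?_
          (subset_closure (hsub ⟨-s, ⟨le_rfl, by linarith⟩, rfl⟩))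
        rw [Metric.mem_ball, dist_eq_norm]
        rw [show z + w + (-s) • v - (z - s • v) = w by rw [neg_smul]; abel]
        exact hwn)
    refine ⟨⟨_, hx⟩, hrU ?_, ?_⟩
    · rw [Metric.mem_ball, dist_eq_norm]
      calc ‖z + w + t • v - z‖ = ‖w + t • v‖ := by congr 1; abel
        _ ≤ ‖(w : EuclideanSpace ℝ (Fin n))‖ + ‖t • v‖ := norm_add_le _ _
        _ ≤ ρ + s * ‖v‖ := by
          rw [norm_smul, Real.norm_eq_abs]
          gcongr
          exact abs_le.2 ht
        _ < r := by linarith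
    · simp only [map_add, map_smul, hPv, hPw, smul_zero, add_zero, hw]
      abel
  have hpos : 0 < Measure.euclideanHausdorffMeasure (n - 1) (Metric.ball (P z) ρ) := by
    rw [← hfin]
    exact Metric.measure_ball_pos _ _ hρ
  have hlip : LipschitzWith 1 (fun x : frontier D => P x) := by
    have := W.lipschitzWith_orthogonalProjectionOnto.comp (LipschitzWith.subtype_val (frontier D))
    rwa [one_mul] at this
  refine (hpos.trans_le ((measure_mono himage).trans ?_)).ne'
  simp only [Measure.euclideanHausdorffMeasure_def, Measure.smul_apply]
  gcongr
  simpa using hlip.hausdorffMeasure_image_le (Nat.cast_nonneg (n - 1)) (Subtype.val ⁻¹' U)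

/-- For `n ≥ 2` the Hausdorff dimension parameter `n - 1` is positive, so points are null. -/
theorem densityMeasure_singleton {N : Set (EuclideanSpace ℝ (Fin n))} (hn : 2 ≤ n) (g : N → ℝ)
    (y : N) : densityMeasure N g {y} = 0 := by
  refine withDensity_absolutelyContinuous _ _ ?_
  have : NullSingletonClass (Measure.hausdorffMeasure ((n - 1 : ℕ) : ℝ) : Measure N) :=
    Measure.nullSingletonClass_hausdorff N (by exact_mod_cast (by omega : 0 < n - 1))
  simp [Measure.euclideanHausdorffMeasure_def, measure_singleton]

theorem IsStrictlyConvexHypersurface.isOpenPosMeasure_densityMeasure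
    {M : Set (EuclideanSpace ℝ (Fin n))} (hn : 1 ≤ n) (hM : IsStrictlyConvexHypersurface M)
    {f : M → ℝ} (hf : Continuous f) (hpos : ∀ x, 0 < f x) :
    (densityMeasure M f).IsOpenPosMeasure := by
  obtain ⟨D, hD, rfl⟩ := hM.bounds
  have := isOpenPosMeasure_frontier hn hD.isOpen hD.convex hD.nonempty
  exact (withDensity_absolutelyContinuous'
    (ENNReal.measurable_ofReal.comp hf.measurable).aemeasurable
    (Filter.Eventually.of_forall fun x => by simpa using hpos x)).isOpenPosMeasure


/-! ### Cost, contact set, closedness of `Γ`, and the box transform. -/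

section

variable {M N : Set (EuclideanSpace ℝ (Fin n))}

theorem cost_comm (x y : EuclideanSpace ℝ (Fin n)) : cost x y = cost y x := by
  rw [cost, cost, norm_sub_rev]

@[fun_prop]
theorem continuous_cost_comp {X : Type*} [TopologicalSpace X]
    {u v : X → EuclideanSpace ℝ (Fin n)} (hu : Continuous u) (hv : Continuous v) :
    Continuous fun p => cost (u p) (v p) := by
  unfold cost
  fun_prop

/-- The squared norms cancel: a difference of two quadratic costs is affine in the first variable.
-/
theorem cost_sub_cost_sub (x z y y₀ : EuclideanSpace ℝ (Fin n)) :
    (cost z y - cost x y) - (cost z y₀ - cost x y₀) =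
      inner ℝ (y - y₀) x - inner ℝ (y - y₀) z := by
  simp only [cost, norm_sub_sq_real, inner_sub_left, real_inner_comm]
  rw [real_inner_comm y x, real_inner_comm y z, real_inner_comm y₀ x, real_inner_comm y₀ z]
  ring

/-- The pairs at which the constraint of the dual problem is an equality. -/
def contactSet (φ : M → ℝ) (ψ : N → ℝ) : Set (M × N) :=
  {p | φ p.1 + ψ p.2 = cost (p.1 : EuclideanSpace ℝ (Fin n)) p.2}

variable {φ : M → ℝ} {ψ : N → ℝ}

theorem isClosed_contactSet (hφ : Continuous φ) (hψ : Continuous ψ) :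
    IsClosed (contactSet φ ψ) :=
  isClosed_eq (by fun_prop) (by fun_prop)

/-- `Γ` is the projection of a closed set along the compact factor `N`. -/
theorem isClosed_Gamma [CompactSpace N] (hφ : Continuous φ) : IsClosed (Gamma N φ) := by
  have hS : IsClosed {p : M × N | ∀ z : M, Theta φ p.2 z ≤ Theta φ p.2 p.1} := by
    simp only [Set.ofPred_forall]
    refine isClosed_iInter fun z => isClosed_le ?_ ?_ <;> unfold Theta <;> fun_prop
  convert isClosedMap_fst_of_compactSpace _ hS using 1
  ext x
  simp [Gamma]

/-- The double transform never exceeds `φ`; the `y` witnessing `x ∈ Γ` attains equality. -/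
theorem boxTransform_boxTransform_eq [CompactSpace M] (hφ : Continuous φ) {x : M}
    (hx : x ∈ Gamma N φ) : boxTransform M (boxTransform N φ) x = φ x := by
  obtain ⟨y, hy⟩ := hx
  have hbdd : ∀ y : N, BddAbove (Set.range fun z : M =>
      cost (z : EuclideanSpace ℝ (Fin n)) y - φ z) := fun y =>
    (isCompact_range (by fun_prop)).bddAbove
  have hle : ∀ y : N, cost (y : EuclideanSpace ℝ (Fin n)) x - boxTransform N φ y ≤ φ x := by
    intro y
    have := le_ciSup (hbdd y) x
    rw [cost_comm, sub_le_comm]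
    exact this
  have hxy : boxTransform N φ y ≤ cost (x : EuclideanSpace ℝ (Fin n)) y - φ x := by
    have : Nonempty M := ⟨x⟩
    exact ciSup_le hy
  have : Nonempty N := ⟨y⟩
  refine le_antisymm (ciSup_le hle) ?_
  refine le_trans ?_ (le_ciSup ⟨φ x, Set.forall_mem_range.2 hle⟩ y)
  rw [cost_comm]
  linarith

/-! ### Kantorovich pairs: first variation, uniqueness of contacts, transport map. -/

section Pair

variable {μ : Measure M} {ν : Measure N} (h : IsKantorovichPair μ ν φ ψ)

include h

theorem IsKantorovichPair.mem_contactSet_of_le {x : M} {y : N}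
    (hxy : ∀ z : N, Theta ψ x y ≤ Theta ψ x z) : (x, y) ∈ contactSet φ ψ := by
  refine le_antisymm (h.admissible.add_le x y) ?_
  have : Nonempty N := ⟨y⟩
  have h' : Theta ψ x y ≤ φ x := by
    rw [h.eq_star_right]
    exact le_ciInf hxy
  rw [Theta, cost_comm] at h'
  change cost (x : EuclideanSpace ℝ (Fin n)) y ≤ φ x + ψ y
  linarith

theorem IsKantorovichPair.mem_Omega_iff {x : M} {y : N} :
    y ∈ Omega ψ x ↔ (x, y) ∈ contactSet φ ψ := by
  refine ⟨h.mem_contactSet_of_le, fun hxy z => ?_⟩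
  have h1 := h.admissible.add_le x z
  have h2 : φ x + ψ y = cost (x : EuclideanSpace ℝ (Fin n)) y := hxy
  rw [Theta, Theta, cost_comm, cost_comm (z : EuclideanSpace ℝ (Fin n)) x]
  linarith

theorem IsKantorovichPair.exists_mem_contactSet [CompactSpace N] [Nonempty N] (x : M) :
    ∃ y, (x, y) ∈ contactSet φ ψ := by
  have hψ := h.admissible.continuous_right
  obtain ⟨y, -, hy⟩ := (isCompact_univ (X := N)).exists_isMinOn Set.univ_nonempty
    (f := Theta ψ x) (by unfold Theta; fun_prop)
  exact ⟨y, h.mem_contactSet_of_le fun z => hy (Set.mem_univ z)⟩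

/-- First variation of the dual problem at a maximizer. -/
theorem IsKantorovichPair.integral_add_integral_nonpos [CompactSpace M] [CompactSpace N]
    [IsProbabilityMeasure μ] [IsFiniteMeasure ν] {a : M → ℝ} {b : N → ℝ} (ha : Continuous a)
    (hb : Continuous b) (hab : ∀ p ∈ contactSet φ ψ, a p.1 + b p.2 ≤ 0) :
    ∫ x, a x ∂μ + ∫ y, b y ∂ν ≤ 0 := by
  have hφ := h.admissible.continuous_left
  have hψ := h.admissible.continuous_right
  have hint : ∀ {u : M → ℝ}, Continuous u → Integrable u μ := fun hu =>
    hu.integrable_of_hasCompactSupport (HasCompactSupport.of_compactSpace _)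
  have hint' : ∀ {u : N → ℝ}, Continuous u → Integrable u ν := fun hu =>
    hu.integrable_of_hasCompactSupport (HasCompactSupport.of_compactSpace _)
  refine le_of_forall_pos_le_add fun δ hδ => ?_
  let gap : M × N → ℝ := fun p => cost (p.1 : EuclideanSpace ℝ (Fin n)) p.2 - (φ p.1 + ψ p.2)
  have hgap : Continuous gap := by fun_prop
  have hgap0 : ∀ p, 0 ≤ gap p := fun p => sub_nonneg.2 (h.admissible.add_le p.1 p.2)
  have hs : Continuous fun p : M × N => a p.1 + b p.2 := by fun_prop
  -- Where `a + b ≥ δ` the gap has a positive minimum by compactness, which fixes `ε`; elsewhere the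
  -- left side is nonpositive. Thus `(φ + ε(a - δ), ψ + εb)` is admissible.
  obtain ⟨ε, hε, hle⟩ : ∃ ε : ℝ, 0 < ε ∧ ∀ p : M × N, ε * (a p.1 + b p.2 - δ) ≤ gap p := by
    have hK : IsCompact {p : M × N | δ ≤ a p.1 + b p.2} :=
      (isClosed_le continuous_const hs).isCompact
    rcases Set.eq_empty_or_nonempty {p : M × N | δ ≤ a p.1 + b p.2} with hem | hne
    · refine ⟨1, one_pos, fun p => ?_⟩
      have hp : ¬ δ ≤ a p.1 + b p.2 := fun hp => (Set.eq_empty_iff_forall_notMem.1 hem p) hp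
      have := not_le.1 hp
      linarith [hgap0 p]
    obtain ⟨p₀, hp₀, hmin⟩ := hK.exists_isMinOn hne hgap.continuousOn
    obtain ⟨p₁, hp₁, hmax⟩ := hK.exists_isMaxOn hne hs.continuousOn
    have hm : 0 < gap p₀ := by
      refine lt_of_le_of_ne (hgap0 p₀) fun h0 => ?_
      have := hab p₀ (sub_eq_zero.1 h0.symm).symm
      have hp₀' : δ ≤ a p₀.1 + b p₀.2 := hp₀
      linarith
    have hS : 0 < a p₁.1 + b p₁.2 := hδ.trans_le hp₁
    refine ⟨gap p₀ / (a p₁.1 + b p₁.2), by positivity, fun p => ?_⟩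
    by_cases hp : δ ≤ a p.1 + b p.2
    · have h1 : a p.1 + b p.2 ≤ a p₁.1 + b p₁.2 := hmax hp
      have h2 : gap p₀ ≤ gap p := hmin hp
      refine le_trans ?_ h2
      rw [div_mul_eq_mul_div, div_le_iff₀ hS]
      gcongr
      linarith
    · refine le_trans ?_ (hgap0 p)
      exact mul_nonpos_of_nonneg_of_nonpos (by positivity) (by linarith [not_le.1 hp])
  have hdual := h.dualValue_le (fun x => φ x + ε * (a x - δ)) (fun y => ψ y + ε * b y)
    ⟨by fun_prop, by fun_prop, fun x y => by
      have := hle (x, y)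
      simp only [gap] at this
      linarith⟩
  simp only [dualValue] at hdual
  rw [integral_add (hint hφ) (hint (by fun_prop)), integral_add (hint' hψ) (hint' (by fun_prop)),
    integral_const_mul, integral_const_mul, integral_sub (hint ha) (hint continuous_const),
    integral_const] at hdual
  simp only [probReal_univ, one_smul] at hdual
  have : ε * (∫ x, a x ∂μ + ∫ y, b y ∂ν - δ) ≤ 0 := by linarith
  linarith [nonpos_of_mul_nonpos_right this hε]

theorem IsKantorovichPair.inner_le_of_mem_contactSet {x : M} {y y₀ : N}
    (hxy : (x, y) ∈ contactSet φ ψ) (hy₀ : ∀ z : M, Theta φ y₀ z ≤ Theta φ y₀ x) (z : M) :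
    inner ℝ ((y : EuclideanSpace ℝ (Fin n)) - y₀) z ≤
      inner ℝ ((y : EuclideanSpace ℝ (Fin n)) - y₀) x := by
  have h1 := h.admissible.add_le z y
  have h2 : φ x + ψ y = cost (x : EuclideanSpace ℝ (Fin n)) y := hxy
  have h3 := hy₀ z
  simp only [Theta] at h3
  have := cost_sub_cost_sub (x : EuclideanSpace ℝ (Fin n)) z y y₀
  linarith

/-- If `ν` has no atom at `y₀`, then `y₀` cannot be in contact with all of `M`. -/
theorem IsKantorovichPair.exists_notMem_contactSet (hM : IsStrictlyConvexHypersurface M)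
    (hN : IsStrictlyConvexHypersurface N) [μ.IsOpenPosMeasure] [IsProbabilityMeasure μ]
    [IsFiniteMeasure ν] (y₀ : N) (hatom : ν {y₀} = 0) : ∃ x, (x, y₀) ∉ contactSet φ ψ := by
  by_contra! hall
  have : CompactSpace M := isCompact_iff_compactSpace.1 hM.isCompact
  have : CompactSpace N := isCompact_iff_compactSpace.1 hN.isCompact
  obtain ⟨D, hD, hMD⟩ := hM.bounds
  obtain ⟨D', hD', hND⟩ := hN.bounds
  obtain ⟨e, he0, he⟩ := exists_supporting_normal hD'.isOpen hD'.nonempty hD'.convex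
    (hND ▸ y₀.2 : (y₀ : EuclideanSpace ℝ (Fin n)) ∈ frontier D')
  obtain ⟨q, hq⟩ := hD.nonempty
  obtain ⟨t, ht, hz⟩ := exists_pos_add_smul_mem_frontier hD.isOpen hD.isBounded hq he0
  rw [← hMD] at hz
  -- `V` is the part of `M` from which a step of length `t‖e‖` along `-e` lands in `D`. There every
  -- nonzero outward normal pairs positively with `e`, whereas `⟨e, y - y₀⟩ ≤ 0` on `N` because `e`
  -- supports `N` at `y₀`.
  let V : Set M := {z | (z : EuclideanSpace ℝ (Fin n)) - t • e ∈ D}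
  have hV : IsOpen V := hD.isOpen.preimage (by fun_prop)
  have hzV : (⟨_, hz⟩ : M) ∈ V := by simpa [V] using hq
  have huniq : ∀ z ∈ V, ∀ y, (z, y) ∈ contactSet φ ψ → y = y₀ := by
    intro z hzV y hzy
    by_contra hne
    have hd : (y : EuclideanSpace ℝ (Fin n)) - y₀ ≠ 0 := sub_ne_zero.2 fun h' =>
      hne (Subtype.ext h')
    have hin := h.inner_le_of_mem_contactSet hzy (y₀ := y₀) fun w => by
      have h1 : φ w + ψ y₀ = cost (w : EuclideanSpace ℝ (Fin n)) y₀ := hall w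
      have h2 : φ z + ψ y₀ = cost (z : EuclideanSpace ℝ (Fin n)) y₀ := hall z
      simp only [Theta]
      linarith
    have hlt := inner_lt_of_forall_frontier hD.isOpen hD.isBounded hd
      (fun w hw => hin ⟨w, hMD ▸ hw⟩) hzV
    rw [inner_sub_right, inner_smul_right, inner_sub_left _ _ e, real_inner_comm e y,
      real_inner_comm e y₀] at hlt
    have hy := he y (hND ▸ y.2 : (y : EuclideanSpace ℝ (Fin n)) ∈ frontier D').1
    have : t * (inner ℝ e (y : EuclideanSpace ℝ (Fin n)) - inner ℝ e y₀) ≤ 0 :=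
      mul_nonpos_of_nonneg_of_nonpos ht.le (by linarith)
    linarith
  obtain ⟨k, hk0, hk1, hk⟩ := exists_continuous_zero_one_of_isClosed hV.isClosed_compl
    (isClosed_singleton (x := (⟨_, hz⟩ : M))) (Set.disjoint_singleton_right.2 fun h' => h' hzV)
  have hkpos : 0 < ∫ x, k x ∂μ :=
    k.continuous.integral_pos_of_hasCompactSupport_nonneg_nonzero
      (HasCompactSupport.of_compactSpace _) (fun x => (hk x).1)
      (x := ⟨_, hz⟩) (by rw [hk1 rfl]; exact one_ne_zero)
  obtain ⟨O, hyO, hO, hνO⟩ := Set.exists_isOpen_lt_of_lt (μ := ν) {y₀}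
    (ENNReal.ofReal (∫ x, k x ∂μ)) (by rw [hatom]; simpa using hkpos)
  obtain ⟨b, hb0, hb1, hb⟩ := exists_continuous_zero_one_of_isClosed hO.isClosed_compl
    (isClosed_singleton (x := y₀))
    (Set.disjoint_singleton_right.2 fun h' => h' (hyO rfl))
  -- On contacts `k ≤ b`: over `V` the only contact is `y₀`, where `b = 1`, and off `V` one has `k =
  -- 0`. So `∫ k dμ ≤ ∫ b dν ≤ ν(O)`, against the choice of `O`.
  have hvar := h.integral_add_integral_nonpos k.continuous (b := fun y => - b y)
    (by fun_prop) (fun p hp => by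
      by_cases hpV : p.1 ∈ V
      · rw [huniq _ hpV _ hp, hb1 rfl]
        simpa using (hk p.1).2
      · rw [hk0 hpV]
        simpa using (hb p.2).1)
  rw [integral_neg] at hvar
  have hbO : ∫ y, b y ∂ν ≤ ν.real O := by
    rw [← integral_indicator_one hO.measurableSet]
    refine integral_mono (b.continuous.integrable_of_hasCompactSupport
      (HasCompactSupport.of_compactSpace _))
      ((integrable_const (1 : ℝ)).indicator hO.measurableSet) fun y => ?_
    by_cases hy : y ∈ O
    · simpa [hy] using (hb y).2
    · simp [hy, hb0 (Set.mem_compl hy)]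
  have : ν.real O < ∫ x, k x ∂μ := by
    rw [measureReal_def]
    exact (ENNReal.lt_ofReal_iff_toReal_lt hνO.ne_top).1 hνO
  linarith

theorem IsKantorovichPair.eq_of_mem_contactSet (hM : IsStrictlyConvexHypersurface M)
    (hN : IsStrictlyConvexHypersurface N) [μ.IsOpenPosMeasure] [IsProbabilityMeasure μ]
    [IsFiniteMeasure ν] (hatom : ∀ y, ν {y} = 0) {x : M} (hx : x ∈ Gamma N φ) {y₁ y₂ : N}
    (h₁ : (x, y₁) ∈ contactSet φ ψ) (h₂ : (x, y₂) ∈ contactSet φ ψ) : y₁ = y₂ := by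
  obtain ⟨y₀, hy₀⟩ := hx
  -- At a contact the maximum of `Θ_{y₀}` equals `ψ(y₀)`, its lower bound, so every point of `M`
  -- would be a contact of `y₀`.
  have hnot : (x, y₀) ∉ contactSet φ ψ := fun hc => by
    obtain ⟨z, hz⟩ := h.exists_notMem_contactSet hM hN y₀ (hatom y₀)
    refine hz (le_antisymm (h.admissible.add_le z y₀) ?_)
    have h1 : φ x + ψ y₀ = cost (x : EuclideanSpace ℝ (Fin n)) y₀ := hc
    have h2 := hy₀ z
    simp only [Theta] at h2
    change cost (z : EuclideanSpace ℝ (Fin n)) y₀ ≤ φ z + ψ y₀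
    linarith
  by_contra hne
  obtain ⟨v, hv⟩ := hM.smooth.exists_normal x.2
  obtain ⟨D, hD, hND⟩ := hN.bounds
  obtain ⟨r₁, hr₁⟩ := hv _ fun z hz => h.inner_le_of_mem_contactSet h₁ hy₀ ⟨z, hz⟩
  obtain ⟨r₂, hr₂⟩ := hv _ fun z hz => h.inner_le_of_mem_contactSet h₂ hy₀ ⟨z, hz⟩
  have hmem : ∀ y : N, (y : EuclideanSpace ℝ (Fin n)) ∈ frontier D := fun y => hND ▸ y.2
  refine not_collinear_of_mem_frontier hD.isOpen hD.convex hD.nonempty hD.strictConvex_closure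
    (hmem y₀) (hmem y₁) (hmem y₂) (fun h' => ?_) (fun h' => hne (Subtype.ext h')) (fun h' => ?_) ?_
  · rw [Subtype.ext h'] at hnot
    exact hnot h₁
  · rw [← Subtype.ext h'] at hnot
    exact hnot h₂
  · refine (collinear_iff_of_mem (p₀ := (y₀ : EuclideanSpace ℝ (Fin n))) (by simp)).2 ⟨v, ?_⟩
    rintro p (rfl | rfl | rfl)
    · exact ⟨0, by simp⟩
    · exact ⟨r₁, by rw [← hr₁]; simp⟩
    · exact ⟨r₂, by rw [← hr₂]; simp⟩

/-- If the contact set is the graph of a map, the map is continuous, transports `μ` to `ν`, and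
its graph carries every optimal plan. -/
theorem IsKantorovichPair.transportMap_of_contactSet_eq [CompactSpace M] [CompactSpace N]
    [IsProbabilityMeasure μ] [IsProbabilityMeasure ν] {T : M → N}
    (hT : contactSet φ ψ = {p | p.2 = T p.1}) :
    Continuous T ∧ μ.map T = ν ∧
      ∀ π : Measure (M × N), IsOptimalPlan μ ν π → π.support ⊆ {p | p.2 = T p.1} := by
  have hφ := h.admissible.continuous_left
  have hψ := h.admissible.continuous_right
  have hclosed := isClosed_contactSet hφ hψ
  have hmem : ∀ x, φ x + ψ (T x) = cost (x : EuclideanSpace ℝ (Fin n)) (T x) := fun x => by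
    have : (x, T x) ∈ contactSet φ ψ := by rw [hT]; rfl
    exact this
  -- Closed graph with compact target: preimages of closed sets are projections of closed sets.
  have hTc : Continuous T := by
    refine continuous_iff_isClosed.2 fun s hs => ?_
    convert isClosedMap_fst_of_compactSpace _ (hclosed.inter (hs.preimage continuous_snd)) using 1
    ext x
    simp [hT]
  have hmap : μ.map T = ν := by
    have : IsProbabilityMeasure (μ.map T) := Measure.isProbabilityMeasure_map hTc.aemeasurable
    have hle : ∀ b : N → ℝ, Continuous b → ∫ y, b y ∂ν ≤ ∫ x, b (T x) ∂μ := fun b hb => by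
      have := h.integral_add_integral_nonpos (a := fun x => - b (T x)) (by fun_prop) hb
        fun p hp => by
          rw [hT] at hp
          rw [show p.2 = T p.1 from hp]
          simp
      rw [integral_neg] at this
      linarith
    refine ext_of_forall_integral_eq_of_IsFiniteMeasure fun b => ?_
    rw [integral_map hTc.aemeasurable b.continuous.aestronglyMeasurable]
    refine le_antisymm ?_ (hle b b.continuous)
    have := hle (fun y => - b y) (by fun_prop)
    rw [integral_neg, integral_neg] at this
    linarith
  refine ⟨hTc, hmap, fun π hπ => ?_⟩
  rw [← hT]
  have := hπ.isPlan.isProbabilityMeasure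
  have hgraph : Measurable fun x : M => (x, T x) := by fun_prop
  have hplan : IsPlan μ ν (μ.map fun x => (x, T x)) := by
    refine ⟨Measure.isProbabilityMeasure_map hgraph.aemeasurable, ?_, ?_⟩
    · rw [Measure.map_map measurable_fst hgraph]
      exact Measure.map_id
    · rw [Measure.map_map measurable_snd hgraph]
      exact hmap
  have hc : Continuous fun p : M × N => cost (p.1 : EuclideanSpace ℝ (Fin n)) p.2 := by fun_prop
  have hint : ∀ {u : M × N → ℝ}, Continuous u → Integrable u π := fun hu =>
    hu.integrable_of_hasCompactSupport (HasCompactSupport.of_compactSpace _)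
  have hintM : ∀ {u : M → ℝ}, Continuous u → Integrable u μ := fun hu =>
    hu.integrable_of_hasCompactSupport (HasCompactSupport.of_compactSpace _)
  have hcost := hπ.planCost_le _ hplan
  have h1 : planCost (μ.map fun x => (x, T x)) = ∫ x, φ x ∂μ + ∫ y, ψ y ∂ν := by
    rw [planCost, integral_map hgraph.aemeasurable hc.aestronglyMeasurable, ← hmap,
      integral_map hTc.aemeasurable hψ.aestronglyMeasurable,
      ← integral_add (hintM hφ) (hintM (by fun_prop))]
    exact integral_congr_ae (Filter.Eventually.of_forall fun x => (hmem x).symm)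
  have h2 : ∫ p, (φ p.1 + ψ p.2) ∂π = ∫ x, φ x ∂μ + ∫ y, ψ y ∂ν := by
    rw [integral_add (hint (by fun_prop)) (hint (by fun_prop)), ← hπ.isPlan.map_fst,
      ← hπ.isPlan.map_snd, integral_map measurable_fst.aemeasurable hφ.aestronglyMeasurable,
      integral_map measurable_snd.aemeasurable hψ.aestronglyMeasurable]
  let gap : M × N → ℝ := fun p => cost (p.1 : EuclideanSpace ℝ (Fin n)) p.2 - (φ p.1 + ψ p.2)
  have hgap : Continuous gap := by fun_prop
  have hgap0 : 0 ≤ gap := fun p => sub_nonneg.2 (h.admissible.add_le p.1 p.2)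
  -- The plan carried by the graph of `T` costs exactly the dual value, so an optimal `π` costs no
  -- more and its nonnegative gap integrates to zero.
  have hzero : ∫ p, gap p ∂π = 0 := by
    refine le_antisymm ?_ (integral_nonneg hgap0)
    simp only [gap]
    rw [integral_sub (hint hc) (hint (by fun_prop)), h2, ← h1]
    exact sub_nonpos.2 hcost
  refine Measure.support_subset_of_isClosed hclosed ?_
  filter_upwards [(integral_eq_zero_iff_of_nonneg hgap0 (hint hgap)).1 hzero] with p hp
  exact (sub_eq_zero.1 hp).symm

end Pair

end

end Transport

theorem mainTheorem3 (n : ℕ) (hn : 2 ≤ n) (M N : Set (EuclideanSpace ℝ (Fin n)))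
    (hM : Transport.IsStrictlyConvexHypersurface M)
    (hN : Transport.IsStrictlyConvexHypersurface N)
    (f : M → ℝ) (g : N → ℝ) (hf : Continuous f) (hg : Continuous g)
    (hf_nonneg : ∀ x, 0 ≤ f x) (hg_nonneg : ∀ y, 0 ≤ g y)
    (μ : MeasureTheory.Measure M) (ν : MeasureTheory.Measure N)
    (hμ : μ = Transport.densityMeasure M f) (hν : ν = Transport.densityMeasure N g)
    (hμ_prob : MeasureTheory.IsProbabilityMeasure μ)
    (hν_prob : MeasureTheory.IsProbabilityMeasure ν)
    (φ : M → ℝ) (ψ : N → ℝ) (hφψ : Transport.IsKantorovichPair μ ν φ ψ) :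
    IsClosed (Transport.Gamma N φ) ∧
    ((∀ x, f x ≠ 0) →
      (∀ x ∈ Transport.Gamma N φ, ∃ y : N, Transport.Omega ψ x = {y}) ∧
      (Transport.Gamma N φ = Set.univ →
        ∃ T : M → N, Continuous T ∧ μ.map T = ν ∧
          ∀ π : MeasureTheory.Measure (M × N), Transport.IsOptimalPlan μ ν π →
            π.support ⊆ {p : M × N | p.2 = T p.1})) ∧
    (∀ x ∈ Transport.Gamma N φ,
      Transport.boxTransform M (Transport.boxTransform N φ) x = φ x ∧
      φ x = Transport.starTransform M (Transport.starTransform N φ) x) := by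
  have : CompactSpace M := isCompact_iff_compactSpace.1 hM.isCompact
  have : CompactSpace N := isCompact_iff_compactSpace.1 hN.isCompact
  have hφ := hφψ.admissible.continuous_left
  refine ⟨Transport.isClosed_Gamma hφ, fun hf0 => ?_, fun x hx =>
    ⟨Transport.boxTransform_boxTransform_eq hφ hx, ?_⟩⟩
  · have hpos : μ.IsOpenPosMeasure := by
      rw [hμ]
      exact hM.isOpenPosMeasure_densityMeasure (by omega) hf fun x =>
        lt_of_le_of_ne (hf_nonneg x) (hf0 x).symm
    have hatom : ∀ y, ν {y} = 0 := fun y => by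
      rw [hν]
      exact Transport.densityMeasure_singleton hn g y
    have : Nonempty N := MeasureTheory.nonempty_of_isProbabilityMeasure ν
    choose T hT using hφψ.exists_mem_contactSet
    have huniq : ∀ x ∈ Transport.Gamma N φ, ∀ y,
        (x, y) ∈ Transport.contactSet φ ψ ↔ y = T x := fun x hx y =>
      ⟨fun hy => hφψ.eq_of_mem_contactSet hM hN hatom hx hy (hT x), fun hy => hy ▸ hT x⟩
    refine ⟨fun x hx => ⟨T x, ?_⟩, fun hΓ => ⟨T, hφψ.transportMap_of_contactSet_eq ?_⟩⟩
    · ext y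
      rw [hφψ.mem_Omega_iff, huniq x hx, Set.mem_singleton_iff]
    · ext ⟨x, y⟩
      exact huniq x (hΓ ▸ Set.mem_univ x) y
  · rw [← hφψ.eq_star_left, ← hφψ.eq_star_right]
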